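/- Let $G$ be a compactly generated locally compact group with a continuous action by automorphisms on a locally finite tree $T$ (continuity meaning that vertex stabilizers are open in $G$). Suppose that for every vertex $v$ of $T$ the local action of $G$ at $v$, that is, the permutation group induced by the stabilizer of $v$ in $G$ on the set of edges of $T$ emanating from $v$, is nilpotent. Then $G$ fixes a vertex of $T$, or $G$ fixes an edge of $T$ (as an unoriented edge, possibly exchanging its two endpoints), or $G$ is virtually indicable, that is, $G$ has an open subgroup of finite index admitting a continuous surjective homomorphism onto the infinite cyclic group $\mathbf{Z}$. -/

import Mathlib

namespace TreeAction

/-- A topological group is compactly generated if some compact subset generates it as an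
abstract group. -/
def IsCompactlyGeneratedGroup (G : Type*) [Group G] [TopologicalSpace G] : Prop :=
  ∃ K : Set G, IsCompact K ∧ Subgroup.closure K = ⊤

/-- A topological group is virtually indicable if some open subgroup of finite index admits a
continuous surjective homomorphism onto the (discrete) infinite cyclic group. -/
def IsVirtuallyIndicable (G : Type*) [Group G] [TopologicalSpace G] : Prop :=
  ∃ H : Subgroup G, H.FiniteIndex ∧ IsOpen (H : Set G) ∧
    ∃ f : H →* Multiplicative ℤ, Continuous f ∧ Function.Surjective f

variable {G V : Type*} [Group G] [MulAction G V] {T : SimpleGraph V}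

/-- The action of `G` on the vertex set of the graph `T` is an action by graph automorphisms. -/
def ActsByAutomorphisms (G : Type*) {V : Type*} [Group G] [MulAction G V]
    (T : SimpleGraph V) : Prop :=
  ∀ (g : G) (v w : V), T.Adj (g • v) (g • w) ↔ T.Adj v w

/-- The homomorphism from the stabilizer of the vertex `v` to the symmetric group of the set of
edges emanating from `v`. As `T` is a simple graph, an edge emanating from `v` is recorded by its
other endpoint, a neighbor of `v`. -/
def localActionHom (hT : ActsByAutomorphisms G T) (v : V) :
    MulAction.stabilizer G v →* Equiv.Perm (T.neighborSet v) where
  toFun g := (MulAction.toPerm (g : G)).subtypeEquiv fun w => by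
    have h := hT (g : G) v w
    rw [MulAction.mem_stabilizer_iff.mp g.2] at h
    exact h.symm
  map_one' := by ext w; simp
  map_mul' g h := by ext w; exact mul_smul (g : G) (h : G) (w : V)

/-- The local action of `G` at the vertex `v`: the permutation group that the stabilizer of `v`
induces on the set of edges emanating from `v`. -/
def localAction (hT : ActsByAutomorphisms G T) (v : V) :
    Subgroup (Equiv.Perm (T.neighborSet v)) :=
  (localActionHom hT v).range

/-- `G` fixes a vertex of the graph. -/
def FixesVertex (G V : Type*) [Group G] [MulAction G V] : Prop :=
  ∃ v : V, ∀ g : G, g • v = v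

/-- `G` fixes an (unoriented) edge of `T`; its two endpoints may be exchanged. -/
def FixesEdge (G : Type*) {V : Type*} [Group G] [MulAction G V] (T : SimpleGraph V) : Prop :=
  ∃ e ∈ T.edgeSet, ∀ g : G, Sym2.map (fun v => g • v) e = e

end TreeAction

/-! Compact generation gives an invariant subtree with finitely many vertex orbits
(`exists_connected_saturation`). Pruning orbits of leaves ends with a fixed vertex, a preserved edge
or a leafless subtree (`exists_leafless_saturation`).

In the leafless case, restrict to the subgroup preserving the bipartition. It suffices to find in it
an open normal subgroup N of finite index whose vertex stabilizers are all intransitive on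
neighbors: the finite graph N\T then has all degrees at least 2, so it contains a cycle, which
yields a nontrivial homomorphism to Z (`exists_hom_int`).

Where a stabilizer is transitive, nilpotency puts the stabilizer of a neighbor inside a proper
normal subgroup with abelian quotient (`map_abelianization_ne_top`). The resulting finite abelian
character extends to the whole group (`exists_hom_extending`), and its kernel is intransitive at
that vertex; N is the intersection of such kernels over orbit representatives. Both homomorphisms
arise from a vertex function with prescribed increments along edges (`exists_potential`) that group
elements shift by constants, in the extension only off one orbit. -/

namespace TreeAction

/-! ### Potentials on trees -/

/-- On a tree, every antisymmetric function on oriented edges is a coboundary. -/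
theorem exists_potential {V A : Type*} [AddCommGroup A] {T : SimpleGraph V} (hT : T.IsTree)
    (c : V → V → A) (hc : ∀ x y, T.Adj x y → c y x = -c x y) :
    ∃ f : V → A, ∀ x y, T.Adj x y → f y - f x = c x y := by
  obtain ⟨v₀⟩ := hT.connected.nonempty
  choose p hp using fun x => (hT.existsUnique_path v₀ x).exists
  refine ⟨fun x => ((p x).darts.map fun d => c d.fst d.snd).sum, ?_⟩
  have key : ∀ x y, T.Adj x y → x ∈ (p y).support →
      ((p y).darts.map fun d => c d.fst d.snd).sum -
        ((p x).darts.map fun d => c d.fst d.snd).sum = c x y := by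
    intro x y hxy hx
    rw [hT.isAcyclic.path_concat (hp x) (hp y) hxy hx]
    simp [SimpleGraph.Walk.darts_concat]
  intro x y hxy
  by_cases hx : x ∈ (p y).support
  · exact key x y hxy hx
  · have h := key y x hxy.symm
      (hT.isAcyclic.mem_support_of_ne_mem_support_of_adj_of_isPath (hp x) (hp y) hxy hx)
    rw [hc x y hxy] at h
    rw [← neg_sub, h, neg_neg]

/-- A function on a preconnected graph that agrees on adjacent vertices is constant. -/
theorem eq_of_forall_adj {V A : Type*} {T : SimpleGraph V} (hT : T.Preconnected) (f : V → A)
    (hf : ∀ x y, T.Adj x y → f x = f y) (x y : V) : f x = f y := by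
  obtain ⟨p⟩ := hT x y
  induction p with
  | nil => rfl
  | cons h _ ih => exact (hf _ _ h).trans ih

/-- A function that every group element shifts by a constant along an orbit defines a
homomorphism. -/
theorem exists_hom_of_shift {G V A : Type*} [Group G] [MulAction G V] [AddCommGroup A] (f : V → A)
    (v : V) (hf : ∀ g h : G, f (g • v) - f v = f (g • h • v) - f (h • v)) :
    ∃ φ : G →* Multiplicative A, ∀ g, φ g = .ofAdd (f (g • v) - f v) :=
  ⟨{ toFun := fun g => .ofAdd (f (g • v) - f v)
     map_one' := by simp
     map_mul' := fun a b => by rw [← ofAdd_add, hf a b, mul_smul, sub_add_sub_cancel] },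
    fun _ => rfl⟩

/-! ### Finite nilpotent quotients -/

/-- In a finite nilpotent quotient of `S`, a proper subgroup does not surject onto the
abelianization. -/
theorem map_abelianization_ne_top {S F : Type*} [Group S] [Group F] [Finite F]
    [Group.IsNilpotent F] (ρ : S →* F) (L : Subgroup S) (hker : ρ.ker ≤ L) (hL : L ≠ ⊤) :
    (L.map Abelianization.of).FiniteIndex ∧ L.map Abelianization.of ≠ ⊤ := by
  have hLfin : L.FiniteIndex := Subgroup.finiteIndex_of_le hker
  refine ⟨⟨fun h0 => hLfin.index_ne_zero ?_⟩, ?_⟩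
  · have := Subgroup.index_map_dvd L (f := Abelianization.of)
      (QuotientGroup.mk'_surjective (commutator S))
    rw [h0] at this
    exact Nat.eq_zero_of_zero_dvd this
  · have hrange : Function.Surjective ρ.rangeRestrict := ρ.rangeRestrict_surjective
    have hker' : ρ.rangeRestrict.ker ≤ L := by rwa [MonoidHom.ker_rangeRestrict]
    have hL' : L.map ρ.rangeRestrict ≠ ⊤ := by
      intro h
      apply hL
      have := congrArg (Subgroup.comap ρ.rangeRestrict) h
      rwa [Subgroup.comap_map_eq, Subgroup.comap_top, sup_eq_left.mpr hker'] at this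
    -- A maximal subgroup of a nilpotent group is normal; the quotient is simple and solvable, hence
    -- abelian, so the preimage of `M` contains both `L` and the commutators.
    obtain ⟨M, hM, hLM⟩ := (eq_top_or_exists_le_coatom (L.map ρ.rangeRestrict)).resolve_left hL'
    have hMn : M.Normal :=
      Subgroup.NormalizerCondition.normal_of_coatom M Group.normalizerCondition_of_isNilpotent hM
    have hsimple : IsSimpleGroup (ρ.range ⧸ M) :=
      { exists_pair_ne := by
          have : Nontrivial (ρ.range ⧸ M) := QuotientGroup.nontrivial_iff.mpr hM.1
          exact this.exists_pair_ne
        eq_bot_or_eq_top_of_normal := by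
          intro N _
          have hle : M ≤ N.comap (QuotientGroup.mk' M) := by
            conv_lhs => rw [← QuotientGroup.ker_mk' M]
            exact Subgroup.ker_le_comap _ _
          rcases hM.le_iff.mp hle with h | h
          · right
            have := Subgroup.map_comap_eq_self_of_surjective (QuotientGroup.mk'_surjective M) N
            rw [← this, h, ← MonoidHom.range_eq_map]
            exact MonoidHom.range_eq_top.mpr (QuotientGroup.mk'_surjective M)
          · left
            have := Subgroup.map_comap_eq_self_of_surjective (QuotientGroup.mk'_surjective M) N
            rw [← this, h]
            exact (Subgroup.map_eq_bot_iff _).mpr (QuotientGroup.ker_mk' M).ge }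
    have hcomm : ∀ a b : ρ.range ⧸ M, a * b = b * a :=
      IsSimpleGroup.comm_iff_isSolvable.mpr inferInstance
    have hcl : commutator S ≤ M.comap ρ.rangeRestrict := by
      rw [commutator_eq_closure, Subgroup.closure_le]
      rintro _ ⟨a, b, rfl⟩
      rw [SetLike.mem_coe, Subgroup.mem_comap, ← QuotientGroup.eq_one_iff,
        ← QuotientGroup.mk'_apply, map_commutatorElement, map_commutatorElement]
      exact commutatorElement_eq_one_iff_mul_comm.mpr (hcomm _ _)
    intro htop
    have h1 : L ⊔ commutator S = ⊤ := by
      have := congrArg (Subgroup.comap Abelianization.of) htop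
      rwa [Subgroup.comap_map_eq, Subgroup.comap_top, Abelianization.ker_of] at this
    have h2 : M.comap ρ.rangeRestrict = ⊤ :=
      top_le_iff.mp (h1 ▸ sup_le (Subgroup.map_le_iff_le_comap.mp hLM) hcl)
    apply hM.1
    rw [← Subgroup.map_comap_eq_self_of_surjective hrange M, h2, ← MonoidHom.range_eq_map]
    exact MonoidHom.range_eq_top.mpr hrange

/-! ### Criteria for virtual indicability -/

/-- Virtual indicability passes from an open subgroup of finite index to the whole group. -/
theorem IsVirtuallyIndicable.of_subgroup {G : Type*} [Group G] [TopologicalSpace G]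
    {P : Subgroup G} (hfin : P.FiniteIndex) (hopen : IsOpen (P : Set G))
    (h : IsVirtuallyIndicable P) : IsVirtuallyIndicable G := by
  obtain ⟨H, hHf, hHo, f, hfc, hfs⟩ := h
  let e : H ≃* H.map P.subtype := H.equivMapOfInjective P.subtype P.subtype_injective
  have he : ∀ x : H.map P.subtype, ((e.symm x : P) : G) = x := by
    intro x
    obtain ⟨y, rfl⟩ := e.surjective x
    rw [e.symm_apply_apply]
    rfl
  refine ⟨H.map P.subtype, ⟨?_⟩, ?_, f.comp e.symm.toMonoidHom, ?_, ?_⟩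
  · rw [Subgroup.index_map_subtype]
    exact mul_ne_zero hHf.index_ne_zero hfin.index_ne_zero
  · exact hopen.isOpenMap_subtype_val _ hHo
  · refine hfc.comp ?_
    refine Continuous.subtype_mk (p := fun x => x ∈ H)
      (f := fun x : H.map P.subtype => (e.symm x : P)) ?_ _
    refine Topology.IsInducing.subtypeVal.continuous_iff.mpr ?_
    exact continuous_subtype_val.congr fun x => (he x).symm
  · exact hfs.comp e.symm.surjective

/-- A nontrivial homomorphism to `ℤ` that kills a vertex stabilizer yields a continuous
surjection. -/
theorem isVirtuallyIndicable_of_hom {G V : Type*} [Group G] [TopologicalSpace G]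
    [IsTopologicalGroup G] [MulAction G V] (v : V)
    (hv : IsOpen (MulAction.stabilizer G v : Set G)) (f : G →* Multiplicative ℤ)
    (hf : ∀ g ∈ MulAction.stabilizer G v, f g = 1) {a : G} (ha : f a ≠ 1) :
    IsVirtuallyIndicable G := by
  have hinf : Infinite f.range := by
    refine Infinite.of_injective (fun n : ℤ => (⟨f (a ^ n), a ^ n, rfl⟩ : f.range)) fun m n h => ?_
    have h' := congrArg (fun x : f.range => Multiplicative.toAdd (x : Multiplicative ℤ)) h
    simp only [map_zpow, toAdd_zpow, smul_eq_mul] at h'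
    exact mul_right_cancel₀ (fun h0 => ha (Multiplicative.toAdd.injective h0)) h'
  let f' : G →* Multiplicative ℤ := intCyclicMulEquiv.symm.toMonoidHom.comp f.rangeRestrict
  have hf' : ∀ g ∈ MulAction.stabilizer G v, f' g = 1 := fun g hg => by
    have : f.rangeRestrict g = 1 := Subtype.ext (hf g hg)
    simp [f', this]
  have hcont : Continuous f' := by
    refine continuous_of_continuousAt_one f' ?_
    rw [ContinuousAt, map_one]
    refine tendsto_nhds_of_eventually_eq ?_
    filter_upwards [hv.mem_nhds (one_mem _)] with g hg using hf' g hg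
  refine ⟨⊤, inferInstance, isOpen_univ, f'.comp (Subgroup.subtype ⊤),
    hcont.comp continuous_subtype_val, fun n => ?_⟩
  obtain ⟨g, hg⟩ := (intCyclicMulEquiv.symm.surjective.comp f.rangeRestrict_surjective) n
  exact ⟨⟨g, trivial⟩, hg⟩

/-! ### Extending a character of a vertex stabilizer -/

/-- If the stabilizer of `w` is transitive on the neighbors of `w`, then a homomorphism from it to
an abelian group that kills the stabilizer of a neighbor extends to the whole group. -/
theorem exists_hom_extending {G V A C : Type*} [Group G] [MulAction G V] [AddCommGroup A]
    {T : SimpleGraph V} (hTree : T.IsTree) (hact : ActsByAutomorphisms G T) (τ : V → C)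
    (hτ : ∀ (g : G) x, τ (g • x) = τ x) (hτadj : ∀ x y, T.Adj x y → τ x ≠ τ y) (w x₀ : V)
    (hadj : T.Adj w x₀)
    (htrans : ∀ x, T.Adj w x → ∃ g : G, g • w = w ∧ g • x₀ = x)
    (χ : MulAction.stabilizer G w →* Multiplicative A)
    (hχ : ∀ g : MulAction.stabilizer G w, (g : G) • x₀ = x₀ → χ g = 1) :
    ∃ φ : G →* Multiplicative A, (∀ g : MulAction.stabilizer G w, φ g = χ g) ∧
      ∀ g : G, g • x₀ = x₀ → φ g = 1 := by
  classical
  let ψ : G → A := fun g => if h : g • w = w then (χ ⟨g, h⟩).toAdd else 0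
  have hψ : ∀ (g : G) (h : g • w = w), ψ g = (χ ⟨g, h⟩).toAdd := fun g h => dif_pos h
  have hψmul : ∀ a b : G, a • w = w → b • w = w → ψ (a * b) = ψ a + ψ b := by
    intro a b ha hb
    have hab : (a * b) • w = w := by rw [mul_smul, hb, ha]
    rw [hψ a ha, hψ b hb, hψ _ hab, ← toAdd_mul, ← map_mul]
    rfl
  have hψeq : ∀ a b : G, a • w = w → b • w = w → a • x₀ = b • x₀ → ψ a = ψ b := by
    intro a b ha hb hab
    have h1 : (b⁻¹ * a) • w = w := by rw [mul_smul, ha, inv_smul_eq_iff, hb]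
    have h2 : (b⁻¹ * a) • x₀ = x₀ := by rw [mul_smul, hab, inv_smul_smul]
    have h3 := hψmul b (b⁻¹ * a) hb h1
    rw [mul_inv_cancel_left, hψ _ h1, hχ ⟨_, h1⟩ h2, toAdd_one, add_zero] at h3
    exact h3
  let O : Set V := MulAction.orbit G w
  have hO : ∀ (g : G) y, g • y ∈ O ↔ y ∈ O := fun g y => by
    rw [← MulAction.orbit_eq_iff, ← MulAction.orbit_eq_iff, MulAction.orbit_smul]
  have hτO : ∀ y ∈ O, τ y = τ w := by
    rintro _ ⟨g, rfl⟩
    exact hτ g w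
  have hOadj : ∀ x y, T.Adj x y → x ∈ O → y ∉ O := fun x y h hx hy =>
    hτadj x y h ((hτO x hx).trans (hτO y hy).symm)
  -- `r y` carries `w` to `y`, and `r y * k y x` carries the edge from `w` to `x₀` to the edge from
  -- `y` to `x`. The value 1 elsewhere is a dummy.
  have hr : ∀ y, ∃ g : G, y ∈ O → g • w = y := by
    intro y
    by_cases hy : y ∈ O
    · obtain ⟨g, hg⟩ := hy
      exact ⟨g, fun _ => hg⟩
    · exact ⟨1, fun h => absurd h hy⟩
  choose r hr using hr
  have hk : ∀ y x, ∃ k : G, y ∈ O → T.Adj y x → k • w = w ∧ r y • k • x₀ = x := by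
    intro y x
    by_cases h : y ∈ O ∧ T.Adj y x
    · obtain ⟨k, hk1, hk2⟩ := htrans ((r y)⁻¹ • x) (by
        rw [← hact (r y), smul_inv_smul, hr y h.1]
        exact h.2)
      exact ⟨k, fun _ _ => ⟨hk1, by rw [hk2, smul_inv_smul]⟩⟩
    · exact ⟨1, fun h1 h2 => absurd ⟨h1, h2⟩ h⟩
  choose k hk using hk
  -- `σ g y` measures the failure of `r` to be equivariant. By `hlabel`, `g` changes the labels of
  -- all edges at `y` by this same amount.
  let σ : G → V → A := fun g y => ψ ((r (g • y))⁻¹ * g * r y)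
  have hσw : ∀ (g : G) y, y ∈ O → ((r (g • y))⁻¹ * g * r y) • w = w := by
    intro g y hy
    rw [mul_smul, mul_smul, hr y hy, inv_smul_eq_iff, hr _ ((hO g y).mpr hy)]
  have hlabel : ∀ (g : G) y x, y ∈ O → T.Adj y x →
      ψ (k (g • y) (g • x)) = σ g y + ψ (k y x) := by
    intro g y x hy hyx
    obtain ⟨h1, h2⟩ := hk y x hy hyx
    obtain ⟨h3, h4⟩ := hk (g • y) (g • x) ((hO g y).mpr hy) ((hact g y x).mpr hyx)
    rw [← hψmul _ _ (hσw g y hy) h1]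
    refine hψeq _ _ h3 (by rw [mul_smul, h1, hσw g y hy]) ?_
    rw [mul_smul, mul_smul, mul_smul, h2, eq_inv_smul_iff, h4]
  let c : V → V → A := fun x y =>
    if x ∈ O then ψ (k x y) else if y ∈ O then -ψ (k y x) else 0
  obtain ⟨f, hf⟩ := exists_potential hTree c (by
    intro x y hxy
    by_cases hx : x ∈ O
    · have hy := hOadj x y hxy hx
      simp [c, hx, hy]
    · by_cases hy : y ∈ O <;> simp [c, hx, hy])
  -- The term `σ` compensates the change of labels at vertices of `O`, making the shift constant
  -- along every edge.
  let D : G → V → A := fun g x => f (g • x) - f x + if x ∈ O then σ g x else 0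
  have hDadj : ∀ (g : G) x y, T.Adj x y → x ∈ O → D g x = D g y := by
    intro g x y hxy hx
    have hy := hOadj x y hxy hx
    have h1 := hf x y hxy
    have h2 := hf (g • x) (g • y) ((hact g x y).mpr hxy)
    simp only [c, if_pos hx] at h1
    simp only [c, if_pos ((hO g x).mpr hx), hlabel g x y hx hxy] at h2
    simp only [D, if_pos hx, if_neg hy]
    rw [← h1] at h2
    rw [sub_eq_iff_eq_add] at h2
    rw [h2]
    abel
  have hD : ∀ (g : G) x y, D g x = D g y := by
    intro g
    refine eq_of_forall_adj hTree.connected.preconnected (D g) fun x y hxy => ?_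
    by_cases hx : x ∈ O
    · exact hDadj g x y hxy hx
    by_cases hy : y ∈ O
    · exact (hDadj g y x hxy.symm hy).symm
    have h1 := hf x y hxy
    have h2 := hf (g • x) (g • y) ((hact g x y).mpr hxy)
    simp only [c, if_neg hx, if_neg hy] at h1
    simp only [c, if_neg (mt (hO g x).mp hx), if_neg (mt (hO g y).mp hy)] at h2
    simp only [D, if_neg hx, if_neg hy]
    rw [sub_eq_zero.mp h1, sub_eq_zero.mp h2]
  have hx₀ : x₀ ∉ O := hOadj w x₀ hadj (MulAction.mem_orbit_self w)
  have hDx : ∀ (g : G) x, x ∉ O → D g x = f (g • x) - f x := fun g x hx => by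
    simp [D, hx]
  obtain ⟨φ, hφ⟩ := exists_hom_of_shift (G := G) f x₀ fun a b => by
    rw [← hDx _ _ hx₀, ← hDx _ _ (mt (hO b x₀).mp hx₀), hD]
  refine ⟨φ, ?_, ?_⟩
  · rintro ⟨g, hg⟩
    have hg' : g • w = w := hg
    have hw : w ∈ O := MulAction.mem_orbit_self w
    have hrw : r w • w = w := hr w hw
    have hrw' : (r w)⁻¹ • w = w := by rw [inv_smul_eq_iff, hrw]
    have h1 : ψ ((r w)⁻¹) + ψ (r w) = 0 := by
      rw [← hψmul _ _ hrw' hrw, inv_mul_cancel, hψ 1 (one_smul _ _)]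
      exact congrArg Multiplicative.toAdd (map_one χ)
    -- As `g` fixes `w`, only `σ g w` survives, and conjugation by `r w` is invisible in the abelian
    -- group `A`.
    have h2 : D g w = ψ g := by
      simp only [D, σ, if_pos hw, hg', sub_self, zero_add]
      rw [hψmul _ _ (by rw [mul_smul, hg', hrw']) hrw, hψmul _ _ hrw' hg', add_right_comm, h1,
        zero_add]
    rw [hφ, ← hDx _ _ hx₀, hD g x₀ w, h2, hψ g hg', ofAdd_toAdd]
  · intro g hg
    rw [hφ, hg, sub_self, ofAdd_zero]

/-! ### A cycle in the finite quotient graph -/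

/-- If no vertex stabilizer is transitive on the neighbors of its vertex and there are finitely
many orbits of vertices, then the group has a nontrivial homomorphism to `ℤ`. -/
theorem exists_hom_int {H V : Type*} [Group H] [MulAction H V] {T : SimpleGraph V}
    (hTree : T.IsTree) (hact : ActsByAutomorphisms H T) (τ : V → ZMod 2)
    (hτ : ∀ (h : H) x, τ (h • x) = τ x) (hτadj : ∀ x y, T.Adj x y → τ x ≠ τ y)
    {S : Set V} (hS : S.Finite) (hSV : ∀ v, ∃ s ∈ S, ∃ h : H, h • s = v)
    (hbranch : ∀ x, ∃ y y', T.Adj x y ∧ T.Adj x y' ∧ ∀ h : H, h • x = x → h • y ≠ y') :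
    ∃ φ : H →* Multiplicative ℤ, ∃ v : V, (∀ h : H, h • v = v → φ h = 1) ∧ ∃ a, φ a ≠ 1 := by
  classical
  obtain ⟨v₀⟩ := hTree.connected.nonempty
  let Ω := MulAction.orbitRel.Quotient H V
  let π : V → Ω := fun v => Quotient.mk'' v
  have hπ : ∀ x y, π x = π y ↔ ∃ h : H, h • y = x := fun x y => Quotient.eq''
  have hΩ : Finite Ω := by
    have := hS.to_subtype
    refine Finite.of_surjective (fun s : S => π s) fun ω => ?_
    obtain ⟨v, rfl⟩ := Quotient.exists_rep ω
    obtain ⟨s, hs, h, rfl⟩ := hSV v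
    exact ⟨⟨s, hs⟩, (hπ _ _).mpr ⟨h⁻¹, inv_smul_smul _ _⟩⟩
  have := Fintype.ofFinite Ω
  have hout : ∀ ω : Ω, π ω.out = ω := fun ω => Quotient.out_eq' ω
  -- One color class contains at least half of the orbits. Two edges from each of its members give
  -- at least as many edges as there are vertices in the quotient.
  obtain ⟨t, ht⟩ : ∃ t : ZMod 2,
      Fintype.card Ω ≤ Fintype.card ({ω : Ω // τ ω.out = t} × Bool) := by
    have hcard := Fintype.card_subtype_compl fun ω : Ω => τ ω.out = 0
    have hle := Fintype.card_subtype_le fun ω : Ω => τ ω.out = 0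
    have h1 : Fintype.card {ω : Ω // ¬ τ ω.out = 0} = Fintype.card {ω : Ω // τ ω.out = 1} :=
      Fintype.card_congr (Equiv.subtypeEquivRight fun ω => by
        generalize τ ω.out = z
        revert z
        decide)
    by_contra! hcon
    have h2 := hcon 0
    have h3 := hcon 1
    rw [Fintype.card_prod, Fintype.card_bool] at h2 h3
    omega
  choose y y' hy hy' hyy using hbranch
  let I := {ω : Ω // τ ω.out = t} × Bool
  let src : I → V := fun i => i.1.1.out
  let tgt : I → V := fun i => if i.2 then y (src i) else y' (src i)
  have hst : ∀ i, T.Adj (src i) (tgt i) := by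
    rintro ⟨i, _ | _⟩
    · exact hy' _
    · exact hy _
  have hinj : ∀ (i j : I) (h : H), h • src i = src j → h • tgt i = tgt j → i = j := by
    rintro ⟨⟨ω, hω⟩, b⟩ ⟨⟨ω', hω'⟩, b'⟩ h h1 h2
    have hωω : ω = ω' := by
      rw [← hout ω, ← hout ω']
      exact ((hπ _ _).mpr ⟨h, h1⟩).symm
    subst hωω
    have h1' : h • ω.out = ω.out := h1
    cases b <;> cases b'
    · rfl
    · refine absurd ?_ (hyy ω.out h⁻¹ (by rw [inv_smul_eq_iff, h1']))
      rw [inv_smul_eq_iff]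
      exact h2.symm
    · exact absurd h2 (hyy ω.out h h1')
    · rfl
  have hτsrc : ∀ i, τ (src i) = t := fun i => i.1.2
  have hτtgt : ∀ i, τ (tgt i) ≠ t := fun i h => hτadj _ _ (hst i) ((hτsrc i).trans h.symm)
  let d : (Ω → ℚ) →ₗ[ℚ] (I → ℚ) :=
    { toFun := fun F i => F (π (tgt i)) - F (π (src i))
      map_add' := fun F F' => by ext i; simp only [Pi.add_apply]; ring
      map_smul' := fun a F => by
        ext i
        simp only [Pi.smul_apply, smul_eq_mul, RingHom.id_apply]
        ring }
  -- Constants lie in the kernel of the coboundary `d`, and its target has at least the dimension of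
  -- its source.
  have hdns : ¬ Function.Surjective d := by
    intro hsurj
    have h1 := LinearMap.finrank_le_finrank_of_surjective hsurj
    simp only [Module.finrank_fintype_fun_eq_card] at h1
    have h2 : Module.finrank ℚ (Ω → ℚ) = Module.finrank ℚ (I → ℚ) := by
      simp only [Module.finrank_fintype_fun_eq_card]
      exact le_antisymm ht h1
    have hdinj := (LinearMap.injective_iff_surjective_of_finrank_eq_finrank h2).mpr hsurj
    have h3 : d 1 = d 0 := by
      ext i
      simp [d]
    exact one_ne_zero (congrFun (hdinj h3) (π v₀))
  obtain ⟨i, hi⟩ : ∃ i, ∀ F, d F ≠ Pi.single i 1 := by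
    by_contra! hcon
    choose F hF using hcon
    refine hdns fun c => ⟨∑ i, c i • F i, ?_⟩
    rw [map_sum]
    simp only [map_smul, hF]
    ext j
    simp only [Finset.sum_apply, Pi.smul_apply, Pi.single_apply, smul_eq_mul, mul_ite, mul_one,
      mul_zero]
    exact (Finset.sum_ite_eq Finset.univ j c).trans (if_pos (Finset.mem_univ j))
  -- The orbit of the edge `i`, oriented away from color `t`; preservation of colors prevents
  -- reversal.
  let E : V → V → Prop := fun x z => ∃ h : H, h • src i = x ∧ h • tgt i = z
  have hE : ∀ (h : H) x z, E (h • x) (h • z) ↔ E x z := by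
    intro h x z
    constructor
    · rintro ⟨k, h1, h2⟩
      exact ⟨h⁻¹ * k, by rw [mul_smul, h1, inv_smul_smul], by rw [mul_smul, h2, inv_smul_smul]⟩
    · rintro ⟨k, h1, h2⟩
      exact ⟨h * k, by rw [mul_smul, h1], by rw [mul_smul, h2]⟩
  have hEτ : ∀ x z, E x z → τ x = t ∧ τ z ≠ t := by
    rintro x z ⟨h, rfl, rfl⟩
    rw [hτ, hτ]
    exact ⟨hτsrc i, hτtgt i⟩
  let c : V → V → ℤ := fun x z => if E x z then 1 else if E z x then -1 else 0
  have hc : ∀ (h : H) x z, c (h • x) (h • z) = c x z := fun h x z => by simp only [c, hE]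
  obtain ⟨f, hf⟩ := exists_potential hTree c (by
    intro x z _
    by_cases h1 : E x z
    · have h2 : ¬ E z x := fun h2 => (hEτ _ _ h2).2 (hEτ _ _ h1).1
      simp [c, h1, h2]
    · by_cases h2 : E z x <;> simp [c, h1, h2])
  have hD : ∀ (h : H) x z, f (h • x) - f x = f (h • z) - f z := by
    intro h
    refine eq_of_forall_adj hTree.connected.preconnected (fun x => f (h • x) - f x)
      fun x z hxz => ?_
    have h1 := hf x z hxz
    have h2 := hf (h • x) (h • z) ((hact h x z).mpr hxz)
    rw [hc, ← h1] at h2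
    linarith
  obtain ⟨φ, hφ⟩ := exists_hom_of_shift (G := H) f v₀ fun a b => hD a _ _
  refine ⟨φ, v₀, fun h hh => by rw [hφ, hh, sub_self, ofAdd_zero], ?_⟩
  -- If `φ` is trivial, `f` descends to the quotient and its coboundary is the indicator of `i`,
  -- contrary to the choice of `i`.
  by_contra! hcon
  have hinv : ∀ (h : H) x, f (h • x) = f x := fun h x => by
    have h1 : f (h • v₀) - f v₀ = 0 := by
      rw [← ofAdd_eq_one, ← hφ, hcon h]
    rw [hD h v₀ x] at h1
    linarith
  let F : Ω → ℚ := fun ω => f ω.out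
  have hF : ∀ x, F (π x) = f x := fun x => by
    obtain ⟨h, hh⟩ := (hπ _ _).mp (hout (π x))
    simp only [F, ← hh, hinv]
  refine hi F ?_
  ext j
  change F (π (tgt j)) - F (π (src j)) = _
  rw [hF, hF, ← Int.cast_sub, hf _ _ (hst j)]
  have h2 : ¬ E (tgt j) (src j) := fun h2 => hτtgt j (hEτ _ _ h2).1
  by_cases hij : j = i
  · subst hij
    have h1 : E (src j) (tgt j) := ⟨1, one_smul _ _, one_smul _ _⟩
    simp [c, h1]
  · have h1 : ¬ E (src j) (tgt j) := fun ⟨h, ha, hb⟩ => hij (hinj i j h ha hb).symm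
    simp [c, h1, h2, hij]

/-! ### Leafless trees with finitely many orbits -/

/-- A normal subgroup of finite index of a group with finitely many orbits has finitely many
orbits. -/
theorem exists_finite_orbit_reps {G V : Type*} [Group G] [MulAction G V] (N : Subgroup G)
    [N.Normal] [N.FiniteIndex] {S : Set V} (hS : S.Finite)
    (hSV : ∀ v, ∃ s ∈ S, ∃ g : G, g • s = v) :
    ∃ S' : Set V, S'.Finite ∧ ∀ v, ∃ s ∈ S', ∃ h : N, h • s = v := by
  have : Finite (G ⧸ N) := inferInstance
  refine ⟨Set.image2 (fun (q : G ⧸ N) s => q.out • s) Set.univ S,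
    Set.finite_univ.image2 _ hS, fun v => ?_⟩
  obtain ⟨s, hs, g, rfl⟩ := hSV v
  refine ⟨_, ⟨(g : G ⧸ N), trivial, s, hs, rfl⟩, ?_⟩
  obtain ⟨n, hn⟩ := QuotientGroup.mk_out_eq_mul N g
  refine ⟨⟨g * (n : G)⁻¹ * g⁻¹, Subgroup.Normal.conj_mem ‹_› _ (inv_mem n.2) _⟩, ?_⟩
  simp only [hn, Subgroup.smul_def, ← mul_smul]
  congr 1
  group

section

variable {G V : Type*} [Group G] [TopologicalSpace G] [IsTopologicalGroup G] [MulAction G V]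
  {T : SimpleGraph V}

/-- If each stabilizer of a vertex `w` that moves a neighbor `x` of `w` has a proper abelian
quotient killing the stabilizer of `x`, then some open normal subgroup of finite index is not
transitive at a given vertex. -/
theorem exists_normal_not_transitive_at {C : Type*} (hTree : T.IsTree)
    (hact : ActsByAutomorphisms G T) (hopen : ∀ v : V, IsOpen (MulAction.stabilizer G v : Set G))
    (τ : V → C) (hτ : ∀ (g : G) x, τ (g • x) = τ x) (hτadj : ∀ x y, T.Adj x y → τ x ≠ τ y)
    (w : V) (hdeg : ∃ y y', T.Adj w y ∧ T.Adj w y' ∧ y ≠ y')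
    (hloc : ∀ x, T.Adj w x → (∃ g : G, g • w = w ∧ g • x ≠ x) →
      (((MulAction.stabilizer G x).subgroupOf (MulAction.stabilizer G w)).map
        Abelianization.of).FiniteIndex ∧
      ((MulAction.stabilizer G x).subgroupOf (MulAction.stabilizer G w)).map
        Abelianization.of ≠ ⊤) :
    ∃ N : Subgroup G, N.Normal ∧ N.FiniteIndex ∧ IsOpen (N : Set G) ∧
      ∃ y y', T.Adj w y ∧ T.Adj w y' ∧ ∀ g ∈ N, g • w = w → g • y ≠ y' := by
  obtain ⟨y, y', hy, hy', hne⟩ := hdeg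
  by_cases htrans : ∀ x, T.Adj w x → ∃ g : G, g • w = w ∧ g • y = x
  swap
  · push Not at htrans
    obtain ⟨x, hx, hgx⟩ := htrans
    exact ⟨⊤, inferInstance, inferInstance, isOpen_univ, y, x, hy, hx, fun g _ => hgx g⟩
  obtain ⟨g₁, hg₁, hg₁'⟩ := htrans y' hy'
  obtain ⟨hfin, htop⟩ := hloc y hy ⟨g₁, hg₁, hg₁' ▸ hne.symm⟩
  set L := (MulAction.stabilizer G y).subgroupOf (MulAction.stabilizer G w)
  let B := L.map Abelianization.of
  let χ : MulAction.stabilizer G w →*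
      Multiplicative (Additive (Abelianization (MulAction.stabilizer G w) ⧸ B)) :=
    (QuotientGroup.mk' B).comp Abelianization.of
  have hχ1 : ∀ g, χ g = 1 ↔ Abelianization.of g ∈ B := fun g =>
    QuotientGroup.eq_one_iff (Abelianization.of g)
  obtain ⟨φ, hφ, hφy⟩ := exists_hom_extending hTree hact τ hτ hτadj w y hy htrans χ
    fun g hg => (hχ1 g).mpr (Subgroup.mem_map_of_mem _ hg)
  have : Finite (Multiplicative (Additive (Abelianization (MulAction.stabilizer G w) ⧸ B))) :=
    inferInstanceAs (Finite (_ ⧸ B))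
  refine ⟨φ.ker, inferInstance, inferInstance,
    Subgroup.isOpen_mono (H₁ := MulAction.stabilizer G y) (fun g hg => hφy g hg) (hopen y), ?_⟩
  obtain ⟨g, hg⟩ : ∃ g, Abelianization.of g ∉ B := by
    by_contra! hcon
    refine htop (top_le_iff.mp fun a _ => ?_)
    obtain ⟨g, rfl⟩ := QuotientGroup.mk'_surjective (commutator _) a
    exact hcon g
  have hgw : (g : G) • w = w := g.2
  -- If `n` in the kernel sends `y` to `g • y`, then `n⁻¹ * g` fixes `y`; both `n` and `n⁻¹ * g` map
  -- into `B`, hence so does `g`.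
  refine ⟨y, (g : G) • y, hy, ?_, fun n hn hnw hny => hg ?_⟩
  · have := (hact (g : G) w y).mpr hy
    rwa [hgw] at this
  · let n' : MulAction.stabilizer G w := ⟨n, hnw⟩
    have h1 : Abelianization.of n' ∈ B := by
      rw [← hχ1, ← hφ]
      exact hn
    have h2 : n'⁻¹ * g ∈ L := by
      change (n⁻¹ * (g : G)) • y = y
      rw [mul_smul, ← hny, inv_smul_smul]
    have h3 := mul_mem h1 (Subgroup.mem_map_of_mem Abelianization.of h2)
    rwa [← map_mul, mul_inv_cancel_left] at h3

/-- A group acting on a tree without leaves, with finitely many orbits and preserving the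
bipartition, is virtually indicable if its local actions have suitable abelian quotients. -/
theorem isVirtuallyIndicable_of_type_preserving (hTree : T.IsTree)
    (hact : ActsByAutomorphisms G T) (hopen : ∀ v : V, IsOpen (MulAction.stabilizer G v : Set G))
    (τ : V → ZMod 2) (hτ : ∀ (g : G) x, τ (g • x) = τ x) (hτadj : ∀ x y, T.Adj x y → τ x ≠ τ y)
    {S : Set V} (hS : S.Finite) (hSV : ∀ v, ∃ s ∈ S, ∃ g : G, g • s = v)
    (hdeg : ∀ w, ∃ y y', T.Adj w y ∧ T.Adj w y' ∧ y ≠ y')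
    (hloc : ∀ w x, T.Adj w x → (∃ g : G, g • w = w ∧ g • x ≠ x) →
      (((MulAction.stabilizer G x).subgroupOf (MulAction.stabilizer G w)).map
        Abelianization.of).FiniteIndex ∧
      ((MulAction.stabilizer G x).subgroupOf (MulAction.stabilizer G w)).map
        Abelianization.of ≠ ⊤) :
    IsVirtuallyIndicable G := by
  choose M hMn hMf hMo y y' hy hy' hyy using fun w =>
    exists_normal_not_transitive_at hTree hact hopen τ hτ hτadj w (hdeg w) (hloc w)
  have := hS.to_subtype
  let N : Subgroup G := ⨅ s : S, M s
  have hNn : N.Normal := Subgroup.normal_iInf_normal fun s => hMn s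
  have hNf : N.FiniteIndex := Subgroup.finiteIndex_iInf fun s => hMf s
  have hNo : IsOpen (N : Set G) := by
    rw [Subgroup.coe_iInf]
    exact isOpen_iInter_of_finite fun s => hMo s
  obtain ⟨S', hS', hSV'⟩ := exists_finite_orbit_reps N hS hSV
  obtain ⟨φ, v, hv, a, ha⟩ := exists_hom_int (H := N) hTree (fun n => hact n) τ (fun n => hτ n)
    hτadj hS' hSV' (by
      intro x
      obtain ⟨s, hs, g, rfl⟩ := hSV x
      -- Normality of `N` transports intransitivity from the representative `s` to its translates.
      refine ⟨g • y s, g • y' s, (hact _ _ _).mpr (hy s), (hact _ _ _).mpr (hy' s), ?_⟩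
      rintro ⟨n, hn⟩ h1 h2
      have hmem : g⁻¹ * n * g ∈ N := by
        simpa using Subgroup.Normal.conj_mem hNn n hn g⁻¹
      refine hyy s (g⁻¹ * n * g) (Subgroup.mem_iInf.mp hmem ⟨s, hs⟩) ?_ ?_
      · rw [mul_smul, mul_smul, inv_smul_eq_iff]
        exact h1
      · rw [mul_smul, mul_smul, inv_smul_eq_iff]
        exact h2)
  refine IsVirtuallyIndicable.of_subgroup hNf hNo ?_
  exact isVirtuallyIndicable_of_hom v ((hopen v).preimage continuous_subtype_val) φ
    (fun n hn => hv n hn) ha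

/-- A group acting on a tree without leaves with finitely many orbits and finite nilpotent local
actions is virtually indicable. -/
theorem isVirtuallyIndicable_of_nilpotent {F : V → Type*} [∀ v, Group (F v)] [∀ v, Finite (F v)]
    [∀ v, Group.IsNilpotent (F v)] (hTree : T.IsTree)
    (hact : ActsByAutomorphisms G T) (hopen : ∀ v : V, IsOpen (MulAction.stabilizer G v : Set G))
    {S : Set V} (hS : S.Finite) (hSV : ∀ v, ∃ s ∈ S, ∃ g : G, g • s = v)
    (hdeg : ∀ w, ∃ y y', T.Adj w y ∧ T.Adj w y' ∧ y ≠ y')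
    (ρ : ∀ v, MulAction.stabilizer G v →* F v)
    (hρ : ∀ v (g : MulAction.stabilizer G v), ρ v g = 1 → ∀ x, T.Adj v x → (g : G) • x = x) :
    IsVirtuallyIndicable G := by
  obtain ⟨v₀⟩ := hTree.connected.nonempty
  -- In `ZMod 2` the constant 1 is antisymmetric; its potential is the 2-coloring, and `θ` records
  -- whether colors are swapped.
  obtain ⟨τ, hτ⟩ := exists_potential hTree (fun _ _ => (1 : ZMod 2)) (fun _ _ _ => by decide)
  have hD : ∀ (g : G) x z, τ (g • x) - τ x = τ (g • z) - τ z := by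
    intro g
    refine eq_of_forall_adj hTree.connected.preconnected (fun x => τ (g • x) - τ x)
      fun x z hxz => ?_
    have h2 := hτ (g • x) (g • z) ((hact g x z).mpr hxz)
    rw [← hτ x z hxz, sub_eq_iff_eq_add] at h2
    rw [h2]
    abel
  obtain ⟨θ, hθ⟩ := exists_hom_of_shift (G := G) τ v₀ fun a b => hD a _ _
  have : Finite (Multiplicative (ZMod 2)) := inferInstanceAs (Finite (ZMod 2))
  have hPτ : ∀ (p : θ.ker) x, τ (p • x) = τ x := by
    rintro ⟨p, hp⟩ x
    rw [MonoidHom.mem_ker, hθ, ofAdd_eq_one, hD p v₀ x, sub_eq_zero] at hp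
    exact hp
  have hPo : IsOpen (θ.ker : Set G) :=
    Subgroup.isOpen_mono (H₁ := MulAction.stabilizer G v₀)
      (fun g hg => by
        rw [MonoidHom.mem_ker, hθ, MulAction.mem_stabilizer_iff.mp hg, sub_self, ofAdd_zero])
      (hopen v₀)
  obtain ⟨S', hS', hSV'⟩ := exists_finite_orbit_reps θ.ker hS hSV
  refine IsVirtuallyIndicable.of_subgroup inferInstance hPo
    (isVirtuallyIndicable_of_type_preserving hTree (fun p => hact p)
      (fun v => (hopen v).preimage continuous_subtype_val) τ hPτ
      (fun x z hxz h => ?_) hS' hSV' hdeg ?_)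
  · have := hτ x z hxz
    rw [h, sub_self] at this
    exact zero_ne_one this
  · rintro w x hwx ⟨p, hpw, hpx⟩
    let ι : MulAction.stabilizer θ.ker w →* MulAction.stabilizer G w :=
      { toFun := fun p => ⟨p.1.1, p.2⟩
        map_one' := rfl
        map_mul' := fun _ _ => rfl }
    refine map_abelianization_ne_top ((ρ w).comp ι) _ (fun q hq => hρ w (ι q) hq x hwx) ?_
    intro htop
    have : (⟨p, hpw⟩ : MulAction.stabilizer θ.ker w) ∈
        (MulAction.stabilizer θ.ker x).subgroupOf (MulAction.stabilizer θ.ker w) := by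
      rw [htop]
      trivial
    exact hpx this

end

/-! ### Invariant subtrees -/

variable {G V : Type*} [Group G] [MulAction G V] {T : SimpleGraph V}

/-- The invariant set of vertices generated by `R`. -/
def saturation (G : Type*) {V : Type*} [Group G] [MulAction G V] (R : Finset V) :
    SubMulAction G V where
  carrier := {v | ∃ r ∈ R, ∃ g : G, g • r = v}
  smul_mem' := by
    rintro h _ ⟨r, hr, g, rfl⟩
    exact ⟨r, hr, h * g, mul_smul _ _ _⟩

/-- A compactly generated group has an invariant subtree with finitely many orbits. -/
theorem exists_connected_saturation [TopologicalSpace G] [TopologicalSpace V] [DiscreteTopology V]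
    [ContinuousSMul G V] (hG : IsCompactlyGeneratedGroup G) (hconn : T.Connected)
    (hact : ActsByAutomorphisms G T) :
    ∃ R : Finset V, (T.induce (saturation G R : Set V)).Connected := by
  classical
  obtain ⟨K, hK, hKtop⟩ := hG
  obtain ⟨v₀⟩ := hconn.nonempty
  have hfin : ((fun g : G => g • v₀) '' K).Finite :=
    (hK.image (continuous_id.smul continuous_const)).finite_of_discrete
  let p : ∀ u, T.Walk v₀ u := fun u => (hconn.preconnected v₀ u).some
  -- Paths from `v₀` to its finitely many translates by `K` suffice: concatenating translates of
  -- them reaches the whole orbit of `v₀`.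
  let R : Finset V := insert v₀ (hfin.toFinset.biUnion fun u => (p u).support.toFinset)
  let X := saturation G R
  have hRX : ∀ r ∈ R, r ∈ X := fun r hr => ⟨r, hr, 1, one_smul _ _⟩
  have hv₀ : v₀ ∈ X := hRX _ (Finset.mem_insert_self _ _)
  let v : X := ⟨v₀, hv₀⟩
  have htrans : ∀ (g : G) (a b : X), (T.induce (X : Set V)).Reachable a b →
      (T.induce (X : Set V)).Reachable (g • a) (g • b) := fun g a b h =>
    h.map (G' := T.induce (X : Set V))
      ⟨fun x : X => g • x, fun {a b} hab => (hact g (a : V) (b : V)).mpr hab⟩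
  have hR : ∀ (r : V) (hr : r ∈ R), (T.induce (X : Set V)).Reachable v ⟨r, hRX r hr⟩ := by
    intro r hr
    rcases Finset.mem_insert.mp hr with rfl | hr'
    · exact SimpleGraph.Reachable.refl _
    · obtain ⟨u, hu, hru⟩ := Finset.mem_biUnion.mp hr'
      rw [List.mem_toFinset] at hru
      refine ⟨((p u).takeUntil r hru).induce (X : Set V) fun z hz => hRX z ?_⟩
      refine Finset.mem_insert_of_mem (Finset.mem_biUnion.mpr ⟨u, hu, ?_⟩)
      exact List.mem_toFinset.mpr ((p u).support_takeUntil_subset_support hru hz)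
  have hKv : ∀ g : G, (T.induce (X : Set V)).Reachable v (g • v) := by
    intro g
    have hg : g ∈ Subgroup.closure K := hKtop ▸ Subgroup.mem_top g
    induction hg using Subgroup.closure_induction with
    | mem g hg =>
      refine hR (g • v₀) (Finset.mem_insert_of_mem (Finset.mem_biUnion.mpr
        ⟨g • v₀, hfin.mem_toFinset.mpr ⟨g, hg, rfl⟩, ?_⟩))
      exact List.mem_toFinset.mpr (SimpleGraph.Walk.end_mem_support _)
    | one => rw [one_smul]
    | mul a b _ _ ha hb =>
      rw [mul_smul]
      exact ha.trans (htrans a _ _ hb)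
    | inv a _ ha =>
      have := htrans a⁻¹ _ _ ha
      rw [inv_smul_smul] at this
      exact this.symm
  refine ⟨R, SimpleGraph.connected_iff_exists_forall_reachable _ |>.mpr ⟨v, ?_⟩⟩
  rintro ⟨_, r, hr, g, rfl⟩
  exact (hKv g).trans (htrans g _ _ (hR r hr))

/-- Removing the orbit of a leaf `v` from an invariant subtree leaves an invariant subtree, provided
that the neighbor `u` of `v` is not itself in that orbit. -/
theorem exists_smaller_saturation (hact : ActsByAutomorphisms G T) {R : Finset V}
    (hR : (T.induce (saturation G R : Set V)).Connected) {v u : V} (hv : v ∈ saturation G R)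
    (hu : u ∈ saturation G R)
    (huniq : ∀ z ∈ saturation G R, T.Adj v z → z = u) (huv : u ∉ MulAction.orbit G v) :
    ∃ R' : Finset V, R'.card < R.card ∧ (T.induce (saturation G R' : Set V)).Connected := by
  classical
  have hO : ∀ (g : G) y, g • y ∈ MulAction.orbit G v ↔ y ∈ MulAction.orbit G v := fun g y => by
    rw [← MulAction.orbit_eq_iff, ← MulAction.orbit_eq_iff, MulAction.orbit_smul]
  let R' := R.filter fun r => r ∉ MulAction.orbit G v
  have hX' : ∀ x, x ∈ saturation G R' ↔ x ∈ saturation G R ∧ x ∉ MulAction.orbit G v := by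
    intro x
    constructor
    · rintro ⟨r, hr, g, rfl⟩
      rw [Finset.mem_filter] at hr
      exact ⟨⟨r, hr.1, g, rfl⟩, mt (hO g r).mp hr.2⟩
    · rintro ⟨⟨r, hr, g, rfl⟩, h⟩
      exact ⟨r, Finset.mem_filter.mpr ⟨hr, mt (hO g r).mpr h⟩, g, rfl⟩
  refine ⟨R', Finset.card_lt_card (Finset.filter_ssubset.mpr ?_), ?_⟩
  · obtain ⟨r, hr, g, hg⟩ := hv
    refine ⟨r, hr, fun h => h ?_⟩
    rw [← hO g, hg]
    exact MulAction.mem_orbit_self v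
  -- The retraction folding each leaf in the orbit of `v` onto its only neighbor; it sends adjacent
  -- vertices to equal or adjacent ones, so connectedness survives.
  have hret : ∀ x : saturation G R, ∃ z : saturation G R',
      ((x : V) ∉ MulAction.orbit G v → (z : V) = x) ∧
      ((x : V) ∈ MulAction.orbit G v → ∀ y ∈ saturation G R, T.Adj x y → (z : V) = y) := by
    rintro ⟨x, hx⟩
    by_cases h : x ∈ MulAction.orbit G v
    · obtain ⟨g, rfl⟩ := h
      refine ⟨⟨g • u, (hX' _).mpr ⟨(saturation G R).smul_mem g hu, mt (hO g u).mp huv⟩⟩,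
        fun h' => absurd ⟨g, rfl⟩ h', fun _ y hy hadj => ?_⟩
      have : g⁻¹ • y = u := by
        refine huniq _ ((saturation G R).smul_mem _ hy) ?_
        rw [← hact g, smul_inv_smul]
        exact hadj
      exact (inv_smul_eq_iff.mp this).symm
    · exact ⟨⟨x, (hX' x).mpr ⟨hx, h⟩⟩, fun _ => rfl, fun h' => absurd h' h⟩
  choose ret hret1 hret2 using hret
  have hcomp := eq_of_forall_adj hR.preconnected
    (fun x => (T.induce (saturation G R' : Set V)).connectedComponentMk (ret x)) (by
      have key : ∀ x y : saturation G R, T.Adj (x : V) y → (x : V) ∈ MulAction.orbit G v →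
          ret x = ret y := by
        intro x y hxy hx
        have h1 := hret2 x hx y y.2 hxy
        have hy : (y : V) ∉ MulAction.orbit G v := h1 ▸ ((hX' _).mp (ret x).2).2
        exact Subtype.ext (h1.trans (hret1 y hy).symm)
      intro x y hxy
      have hxy' : T.Adj (x : V) y := hxy
      by_cases hx : (x : V) ∈ MulAction.orbit G v
      · exact congrArg _ (key x y hxy' hx)
      by_cases hy : (y : V) ∈ MulAction.orbit G v
      · exact congrArg _ (key y x hxy'.symm hy).symm
      refine SimpleGraph.ConnectedComponent.connectedComponentMk_eq_of_adj ?_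
      change T.Adj (ret x : V) (ret y)
      rwa [hret1 x hx, hret1 y hy])
  have hret_self : ∀ x : saturation G R', ret ⟨x, ((hX' _).mp x.2).1⟩ = x := fun x =>
    Subtype.ext (hret1 _ ((hX' _).mp x.2).2)
  have : Nonempty (saturation G R' : Set V) := ⟨⟨u, (hX' u).mpr ⟨hu, huv⟩⟩⟩
  refine ⟨fun x y => SimpleGraph.ConnectedComponent.exact ?_⟩
  have := hcomp ⟨x, ((hX' _).mp x.2).1⟩ ⟨y, ((hX' _).mp y.2).1⟩
  rwa [hret_self x, hret_self y] at this

/-- If a group has an invariant subtree with finitely many orbits, then it fixes a vertex or an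
edge, or it has such a subtree without leaves. -/
theorem exists_leafless_saturation (hact : ActsByAutomorphisms G T)
    (hR : ∃ R : Finset V, (T.induce (saturation G R : Set V)).Connected) :
    (FixesVertex G V ∨ FixesEdge G T) ∨
      ∃ R : Finset V, (T.induce (saturation G R : Set V)).Connected ∧
        ∀ w ∈ saturation G R, ∃ y ∈ saturation G R, ∃ y' ∈ saturation G R,
          T.Adj w y ∧ T.Adj w y' ∧ y ≠ y' := by
  classical
  obtain ⟨R, hRc, hmin⟩ := exists_minimalFor_of_wellFoundedLT
    (fun R : Finset V => (T.induce (saturation G R : Set V)).Connected) Finset.card hR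
  by_cases hleaf : ∀ w ∈ saturation G R, ∃ y ∈ saturation G R, ∃ y' ∈ saturation G R,
      T.Adj w y ∧ T.Adj w y' ∧ y ≠ y'
  · exact Or.inr ⟨R, hRc, hleaf⟩
  left
  push Not at hleaf
  obtain ⟨v, hv, hleaf⟩ := hleaf
  by_cases hnbr : ∃ u ∈ saturation G R, T.Adj v u
  swap
  · push Not at hnbr
    left
    refine ⟨v, fun g => ?_⟩
    have := eq_of_forall_adj hRc.preconnected (fun x => (x : V) = v) (by
      rintro ⟨x, hx⟩ ⟨y, hy⟩ hxy
      have hxy' : T.Adj x y := hxy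
      refine propext ⟨?_, ?_⟩
      · rintro rfl
        exact absurd hxy' (hnbr y hy)
      · rintro rfl
        exact absurd hxy'.symm (hnbr x hx)) ⟨v, hv⟩ ⟨g • v, (saturation G R).smul_mem g hv⟩
    exact this.mp rfl
  obtain ⟨u, hu, hvu⟩ := hnbr
  have huniq : ∀ z ∈ saturation G R, T.Adj v z → z = u := fun z hz hvz =>
    hleaf z hz u hu hvz hvu
  -- Minimality of `R` forces `u` into the orbit of `v`. Then `u` is a leaf too, and the subtree is
  -- a single edge.
  by_cases huv : u ∈ MulAction.orbit G v
  swap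
  · obtain ⟨R', hlt, hR'⟩ := exists_smaller_saturation hact hRc hv hu huniq huv
    exact absurd (hmin hR' hlt.le) (not_le.mpr hlt)
  right
  obtain ⟨g₀, rfl⟩ := huv
  have huniq' : ∀ z ∈ saturation G R, T.Adj (g₀ • v) z → z = v := by
    have h : ∀ z ∈ saturation G R, T.Adj (g₀ • v) z → z = g₀ • g₀ • v := by
      intro z hz hadj
      rw [← inv_smul_eq_iff]
      refine huniq _ ((saturation G R).smul_mem _ hz) ?_
      rw [← hact g₀, smul_inv_smul]
      exact hadj
    intro z hz hadj
    rw [h z hz hadj, ← h v hv hvu.symm]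
  have hpair : ∀ x ∈ saturation G R, x = v ∨ x = g₀ • v := by
    intro x hx
    have := eq_of_forall_adj hRc.preconnected (fun x => (x : V) = v ∨ (x : V) = g₀ • v) (by
      have key : ∀ x y : saturation G R, T.Adj (x : V) y → ((x : V) = v ∨ (x : V) = g₀ • v) →
          ((y : V) = v ∨ (y : V) = g₀ • v) := by
        rintro x y hxy (h | h)
        · exact Or.inr (huniq y y.2 (h ▸ hxy))
        · exact Or.inl (huniq' y y.2 (h ▸ hxy))
      intro x y hxy
      have hxy' : T.Adj (x : V) y := hxy
      exact propext ⟨key x y hxy', key y x hxy'.symm⟩) ⟨v, hv⟩ ⟨x, hx⟩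
    exact this.mp (Or.inl rfl)
  refine ⟨s(v, g₀ • v), hvu, fun g => ?_⟩
  have h1 := hpair _ ((saturation G R).smul_mem g hv)
  have h2 := hpair _ ((saturation G R).smul_mem g hu)
  have h3 : g • v ≠ g • g₀ • v := ((hact g _ _).mpr hvu).ne
  rw [Sym2.map_mk, Sym2.eq_iff]
  grind

end TreeAction

/-! ### The theorem -/

/-- The vertex set is discrete, so `ContinuousSMul G V` says that the action on the tree is
continuous, i.e. that vertex stabilizers are open. -/
theorem mainTheorem2 {G V : Type*} [Group G] [TopologicalSpace G] [IsTopologicalGroup G]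
    [LocallyCompactSpace G] (hG : TreeAction.IsCompactlyGeneratedGroup G)
    (T : SimpleGraph V) [T.LocallyFinite] (hTree : T.IsTree)
    [MulAction G V] [TopologicalSpace V] [DiscreteTopology V] [ContinuousSMul G V]
    (hT : TreeAction.ActsByAutomorphisms G T)
    (hnil : ∀ v : V, Group.IsNilpotent (TreeAction.localAction hT v)) :
    (TreeAction.FixesVertex G V ∨ TreeAction.FixesEdge G T) ∨
      TreeAction.IsVirtuallyIndicable G := by
  classical
  have hopen : ∀ v : V, IsOpen (MulAction.stabilizer G v : Set G) := fun v =>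
    (isOpen_discrete {v}).preimage (continuous_id.smul (continuous_const (y := v)))
  refine (TreeAction.exists_leafless_saturation hT
    (TreeAction.exists_connected_saturation hG hTree.connected hT)).imp_right ?_
  rintro ⟨R, hR, hdeg⟩
  have hstab : ∀ v : TreeAction.saturation G R,
      MulAction.stabilizer G v = MulAction.stabilizer G (v : V) := fun v => by
    ext g
    exact Subtype.ext_iff
  have := fun v : TreeAction.saturation G R => hnil v
  refine TreeAction.isVirtuallyIndicable_of_nilpotent
    (V := TreeAction.saturation G R) (T := T.induce (TreeAction.saturation G R : Set V))
    -- The local action on all of `T` serves for the subtree: it is finite and nilpotent, and its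
    -- kernel fixes in particular the neighbors inside the subtree.
    (F := fun v => TreeAction.localAction hT (v : V))
    ⟨hR, hTree.isAcyclic.induce _⟩ (fun g v w => hT g v w)
    (fun v => by rw [hstab]; exact hopen v)
    (S := {v | (v : V) ∈ R}) (R.finite_toSet.preimage Subtype.val_injective.injOn) ?_ ?_
    (fun v => (TreeAction.localActionHom hT (v : V)).rangeRestrict.comp
      (Subgroup.inclusion (hstab v).le)) ?_
  · rintro ⟨_, r, hr, g, rfl⟩
    exact ⟨⟨r, r, hr, 1, one_smul _ _⟩, hr, g, rfl⟩
  · rintro ⟨w, hw⟩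
    obtain ⟨y, hy, y', hy', h1, h2, h3⟩ := hdeg w hw
    exact ⟨⟨y, hy⟩, ⟨y', hy'⟩, h1, h2, fun h => h3 (congrArg Subtype.val h)⟩
  · intro v g hg x hvx
    have h := congrArg Subtype.val hg
    have h' := congrArg (fun e : Equiv.Perm (T.neighborSet (v : V)) =>
      ((e ⟨x, hvx⟩ : T.neighborSet (v : V)) : V)) h
    exact Subtype.ext h'
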